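/- Let $n\ge 3$. A KM-arc of type $\tau$ in $\mathrm{PG}(2,2^n)$ is a set of $2^n+\tau$ points that every line meets in $0$, $2$ or $\tau$ points; it is a translation KM-arc if there is a line $m$ such that the group of elations with axis $m$ stabilising the set acts transitively on its points off $m$. For an $\mathbb F_2$-subspace $U$ of an $\mathbb F_{2^n}$-vector space, let $L_U$ be the set of points $\langle u\rangle_{\mathbb F_{2^n}}$ with $u\in U\setminus\{0\}$; the weight of a point $P=\langle u\rangle_{\mathbb F_{2^n}}$ in $L_U$ is $\dim_{\mathbb F_2}(U\cap\langle u\rangle_{\mathbb F_{2^n}})$, and $L_U\subseteq\mathrm{PG}(1,2^n)$ is an $i$-club if one of its points has weight $i$ and all its other points have weight one. **Theorem.** Let $\mathcal A$ be a translation KM-arc of type $2^{n-2}$ in $\mathrm{PG}(2,2^n)$. Then there are integers $t\ge 2$, $\ell\ge 0$ with $n=t(\ell+1)$, elements $a,b,c\in\mathbb F_{2^n}^*$ with $\mathbb F_2(b)=\mathbb F_{2^t}$, and an $\mathbb F_{2^t}$-subspace $\overline S\subseteq\mathbb F_{2^n}$ of dimension $\ell$ with - $c\,\mathbb F_{2^t}\cap\overline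 S=\{0\}$, - $1\in\overline S\oplus c\langle 1,b,\ldots,b^{t-3}\rangle_{\mathbb F_2}$ (the second summand being $\{0\}$ if $t=2$), - $a\notin\overline S\oplus c\langle 1,b,\ldots,b^{t-2}\rangle_{\mathbb F_2}$, such that, for $$U=\Big\{\Big(\overline s+\sum_{i=0}^{t-3}c\,x_i b^i+\alpha+\beta a,\ \alpha+\beta b\Big)\colon \overline s\in\overline S,\ x_i,\alpha,\beta\in\mathbb F_2\Big\}\subseteq\mathbb F_{2^n}^2,$$ $\dim_{\mathbb F_2}U=n$, $L_U$ is an $(n-2)$-club of $\mathrm{PG}(1,2^n)$, and $\mathcal A$ is $\mathrm{PGL}(3,2^n)$-equivalent to $$\mathcal A(U,(0,0,1))=(L_{U'}\setminus r)\cup(r\setminus L_U),$$ where $r$ is the line $X_2=0$ of $\mathrm{PG}(2,2^n)$, $U$ is identified with $\{(x,y,0)\colon (x,y)\in U\}$, and $U'=U\oplus\langle(0,0,1)\rangle_{\mathbb F_2}$. -/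

import Mathlib

open scoped LinearAlgebra.Projectivization IntermediateField

namespace KMArcs

section Geometry

variable {K V : Type*} [Field K] [AddCommGroup V] [Module K V]

/-- The points of the projective space of `V` that lie on the projective subspace of `W`. -/
def points (W : Submodule K V) : Set (ℙ K V) := {P | P.submodule ≤ W}

/-- Two sets of points are projectively equivalent if an element of `PGL(V)`,
i.e. the projectivity induced by some invertible linear map, carries one onto the other. -/
def ProjEquiv (A B : Set (ℙ K V)) : Prop :=
  ∃ g : V ≃ₗ[K] V, (fun P : ℙ K V => g • P) '' A = B

/-- `W` is a line of the projective space of `V`. -/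
def IsLine (W : Submodule K V) : Prop := Module.finrank K W = 2

/-- The projectivity induced by `g` is an elation with axis `W` (the identity included):
it fixes every point of the axis, and every line through some point (a centre) of the axis. -/
def IsElation (W : Submodule K V) (g : V ≃ₗ[K] V) : Prop :=
  (∀ P ∈ points W, g • P = P) ∧
    ∃ C ∈ points W, ∀ M : Submodule K V, IsLine M → C ∈ points M →
      M.map (g : V →ₗ[K] V) = M

end Geometry

section Arcs

variable {K : Type*} [Field K]

/-- A KM-arc of type `t` in the plane `PG(2, K)`, `K` a finite field: a set of `|K| + t` points
that every line meets in `0`, `2` or `t` points. -/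
def IsKMArc (t : ℕ) (A : Set (ℙ K (Fin 3 → K))) : Prop :=
  A.ncard = Nat.card K + t ∧
    ∀ W : Submodule K (Fin 3 → K), IsLine W →
      (A ∩ points W).ncard = 0 ∨ (A ∩ points W).ncard = 2 ∨ (A ∩ points W).ncard = t

/-- A translation KM-arc of type `t`: for some line, the elations with that line as axis
that stabilise the arc act transitively on the points of the arc off the line. -/
def IsTranslationKMArc (t : ℕ) (A : Set (ℙ K (Fin 3 → K))) : Prop :=
  IsKMArc t A ∧
    ∃ W : Submodule K (Fin 3 → K), IsLine W ∧
      ∀ P ∈ A \ points W, ∀ Q ∈ A \ points W,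
        ∃ g : (Fin 3 → K) ≃ₗ[K] (Fin 3 → K),
          IsElation W g ∧ (fun R : ℙ K (Fin 3 → K) => g • R) '' A = A ∧ g • P = Q

end Arcs

section LinearSets

variable {F K V : Type*} [Field F] [Field K] [Algebra F K]
  [AddCommGroup V] [Module K V] [Module F V] [IsScalarTower F K V]

variable (K) in
/-- The `F`-linear set `L_U` defined by the `F`-subspace `U`. -/
def linearSet (U : Submodule F V) : Set (ℙ K V) :=
  {P | ∃ (u : V) (hu : u ≠ 0), u ∈ U ∧ P = Projectivization.mk K u hu}

/-- The weight of the point `P` in `L_U`. -/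
noncomputable def weight (U : Submodule F V) (P : ℙ K V) : ℕ :=
  Module.finrank F ↥(U ⊓ P.submodule.restrictScalars F)

/-- `L_U` is an `i`-club: one of its points has weight `i`, all the others have weight one.
(This is used on the projective line only.) -/
def IsClub (i : ℕ) (U : Submodule F (Fin 2 → K)) : Prop :=
  ∃ P ∈ linearSet K U, weight U P = i ∧ ∀ Q ∈ linearSet K U, Q ≠ P → weight U Q = 1

end LinearSets

section Construction

variable {F K : Type*} [Field F] [Field K] [Algebra F K]

variable (K) in
/-- The line `X₂ = 0` of `PG(2, K)`. -/
def lineX2 : Submodule K (Fin 3 → K) :=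
  LinearMap.ker (LinearMap.proj (R := K) (φ := fun _ : Fin 3 => K) 2)

variable (F K) in
/-- The identification `(x, y) ↦ (x, y, 0)` of the projective line with the line `X₂ = 0`. -/
def embedLine : (Fin 2 → K) →ₗ[F] (Fin 3 → K) where
  toFun w := ![w 0, w 1, 0]
  map_add' w z := by ext j; fin_cases j <;> simp
  map_smul' r w := by ext j; fin_cases j <;> simp

/-- The point set `A(U, v) = (L_{U'} \ ℓ) ∪ (ℓ \ L_U)`, where `ℓ : X₂ = 0` and
`U' = U + ⟨v⟩_F`. -/
def arcOf (U : Submodule F (Fin 3 → K)) (v : Fin 3 → K) : Set (ℙ K (Fin 3 → K)) :=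
  (linearSet K (U ⊔ Submodule.span F {v}) \ points (lineX2 K)) ∪
    (points (lineX2 K) \ linearSet K U)

/-- The `F`-subspace `S̄ + c⟨1, b, …, b^{m-1}⟩_F` of `K`, for an `F(b)`-subspace `S̄`. -/
noncomputable def sumSpan (b c : K) (S : Submodule F⟮b⟯ K) (m : ℕ) : Submodule F K :=
  S.restrictScalars F ⊔ Submodule.span F {y | ∃ i < m, y = c * b ^ i}

/-- The `F`-subspace
`{(s̄ + ∑_{i=0}^{t-3} c xᵢ bⁱ + α + β a, α + β b) : s̄ ∈ S̄, xᵢ, α, β ∈ F}` of `K²`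
(the sum is empty for `t = 2`). -/
def clubSpace (t : ℕ) (a b c : K) (S : Submodule F⟮b⟯ K) : Submodule F (Fin 2 → K) where
  carrier := {w | ∃ s ∈ S, ∃ (x : Fin (t - 2) → F) (α β : F),
    w = ![s + ∑ i, c * algebraMap F K (x i) * b ^ (i : ℕ) + algebraMap F K α
            + algebraMap F K β * a,
          algebraMap F K α + algebraMap F K β * b]}
  zero_mem' := ⟨0, S.zero_mem, 0, 0, 0, by ext j; fin_cases j <;> simp⟩
  add_mem' := by
    rintro _ _ ⟨s, hs, x, α, β, rfl⟩ ⟨s', hs', x', α', β', rfl⟩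
    refine ⟨s + s', S.add_mem hs hs', x + x', α + α', β + β', ?_⟩
    ext j
    fin_cases j
    · simp [mul_add, add_mul, Finset.sum_add_distrib]
      ring
    · simp
      ring
  smul_mem' := by
    rintro r _ ⟨s, hs, x, α, β, rfl⟩
    refine ⟨r • s, (S.restrictScalars F).smul_mem r hs, r • x, r * α, r * β, ?_⟩
    ext j
    fin_cases j
    · simp [Algebra.smul_def, mul_add, Finset.mul_sum]
      have h : ∀ i : Fin (t - 2), algebraMap F K r * (c * algebraMap F K (x i) * b ^ (i : ℕ)) =
          c * (algebraMap F K r * algebraMap F K (x i)) * b ^ (i : ℕ) := fun i => by ring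
      simp only [h]
      ring
    · simp [Algebra.smul_def]
      ring

/-- The conditions on the parameters of the `(n-2)`-clubs: `n = t(ℓ+1)`, `a, b, c ≠ 0`,
`F(b)` has degree `t ≥ 2` over `F`, `S̄` is an `F(b)`-subspace of dimension `ℓ` meeting `c F(b)`
trivially, `1 ∈ S̄ ⊕ c⟨1, …, b^{t-3}⟩_F` and `a ∉ S̄ ⊕ c⟨1, …, b^{t-2}⟩_F`. -/
structure IsClubData (n t l : ℕ) (a b c : K) (S : Submodule F⟮b⟯ K) : Prop where
  two_le : 2 ≤ t
  degree : n = t * (l + 1)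
  a_ne : a ≠ 0
  b_ne : b ≠ 0
  c_ne : c ≠ 0
  finrank_adjoin : Module.finrank F F⟮b⟯ = t
  finrank_S : Module.finrank F⟮b⟯ S = l
  disjoint : Submodule.span F⟮b⟯ {c} ⊓ S = ⊥
  one_mem : (1 : K) ∈ sumSpan b c S (t - 2)
  a_notMem : a ∉ sumSpan b c S (t - 1)

end Construction

end KMArcs

/-!
The elations with axis `m` that stabilise the arc act on the affine plane off `m` as translations,
so with a point of the arc as origin the affine part of the arc is an `𝔽₂`-subspace `U` of `K²`, and
`m` becomes the line at infinity. A line through the origin meets the arc in an even number of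
points, which forces the part of the arc on `m` to be the complement of `L_U`; counting points then
gives `|U| = 2ⁿ` and shows that `L_U` is an `(n - 2)`-club.

Choose coordinates in which the head of the club is `⟨(1, 0)⟩` and `(1, 0), (0, 1) ∈ U`. Then `U` is
spanned by `S × 0`, `(1, 1)` and some `(a, b)`, where `S` has codimension two in `K`, and all other
weights being one forces `a ∉ S + b S`. A linear form `f` that vanishes on `S + b S` but not at `a`
determines `S̄` and `c`.
-/

namespace KMArcs

section KernelCore

variable {F L V : Type*} [Field F] [Field L] [AddCommGroup V] [Module F V] [Module L V]

variable (L) in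
/-- The largest `L`-subspace of `V` contained in the kernel of the `F`-linear form `f`. -/
def kerCore (f : V →ₗ[F] F) : Submodule L V where
  carrier := {x | ∀ z : L, f (z • x) = 0}
  zero_mem' z := by simp
  add_mem' hx hy z := by rw [smul_add, map_add, hx z, hy z, add_zero]
  smul_mem' w x hx z := by rw [smul_smul]; exact hx (z * w)

variable {f : V →ₗ[F] F}

theorem mem_kerCore {x : V} : x ∈ kerCore L f ↔ ∀ z : L, f (z • x) = 0 := Iff.rfl

theorem apply_eq_zero_of_mem_kerCore {x : V} (hx : x ∈ kerCore L f) : f x = 0 := by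
  simpa using hx 1

variable [Algebra F L] [FiniteDimensional F L] [IsScalarTower F L V]

/- The map `μ ↦ (z ↦ f (z • μ • c))` from `L` to its `F`-dual is injective, hence bijective. -/
theorem exists_forall_apply_smul_smul_eq {c : V} (hc : c ∉ kerCore L f) (φ : Module.Dual F L) :
    ∃ μ : L, ∀ z : L, f (z • μ • c) = φ z := by
  let B : L →ₗ[F] Module.Dual F L :=
    (LinearMap.mul F L).compr₂ (f ∘ₗ (LinearMap.toSpanSingleton L V c).restrictScalars F)
  have B_apply (μ z : L) : B μ z = f ((μ * z) • c) := rfl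
  have B_injective : Function.Injective B := by
    refine (injective_iff_map_eq_zero B).2 fun μ hμ => ?_
    contrapose! hc
    intro z
    have := LinearMap.congr_fun hμ (μ⁻¹ * z)
    rwa [B_apply, mul_inv_cancel_left₀ hc] at this
  have B_surjective : Function.Surjective B :=
    (LinearMap.injective_iff_surjective_of_finrank_eq_finrank
      Subspace.dual_finrank_eq.symm).1 B_injective
  obtain ⟨μ, hμ⟩ := B_surjective φ
  exact ⟨μ, fun z => by rw [← hμ, B_apply, smul_smul, mul_comm]⟩

theorem isCompl_span_singleton_kerCore {c : V} (hc : c ∉ kerCore L f) :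
    IsCompl (Submodule.span L {c}) (kerCore L f) := by
  have hc0 : c ≠ 0 := by rintro rfl; exact hc (zero_mem _)
  refine ⟨((Submodule.disjoint_span_singleton' hc0).2 hc).symm, codisjoint_iff.2 ?_⟩
  refine eq_top_iff.2 fun x _ => Submodule.mem_sup.2 ?_
  obtain ⟨μ, hμ⟩ := exists_forall_apply_smul_smul_eq hc
    (f ∘ₗ (LinearMap.toSpanSingleton L V x).restrictScalars F)
  refine ⟨μ • c, Submodule.smul_mem _ _ (Submodule.mem_span_singleton_self c), x - μ • c,
    fun z => ?_, add_sub_cancel _ _⟩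
  rw [smul_sub, map_sub, hμ, sub_eq_zero]
  rfl

theorem finrank_kerCore_add_one [FiniteDimensional L V] {c : V} (hc : c ∉ kerCore L f) :
    Module.finrank L (kerCore L f) + 1 = Module.finrank L V := by
  have hc0 : c ≠ 0 := by rintro rfl; exact hc (zero_mem _)
  rw [← Submodule.finrank_add_eq_of_isCompl (isCompl_span_singleton_kerCore hc),
    finrank_span_singleton hc0, add_comm]

end KernelCore

section SumSpan

variable {F K : Type*} [Field F] [Field K] [Algebra F K] {b c : K} {T : Submodule F⟮b⟯ K}

theorem mul_pow_mem_sumSpan {i m : ℕ} (hi : i < m) : c * b ^ i ∈ sumSpan b c T m :=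
  Submodule.mem_sup_right (Submodule.subset_span ⟨i, hi, rfl⟩)

theorem sumSpan_le_iff {m : ℕ} {S : Submodule F K} :
    sumSpan b c T m ≤ S ↔ T.restrictScalars F ≤ S ∧ ∀ i < m, c * b ^ i ∈ S := by
  rw [sumSpan, sup_le_iff, Submodule.span_le]
  refine and_congr_right fun _ => ⟨fun h i hi => h ⟨i, hi, rfl⟩, ?_⟩
  rintro h _ ⟨i, hi, rfl⟩
  exact h i hi

theorem sumSpan_zero : sumSpan b c T 0 = T.restrictScalars F :=
  le_antisymm (sumSpan_le_iff.2 ⟨le_rfl, by simp⟩) le_sup_left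

theorem sumSpan_succ (m : ℕ) :
    sumSpan b c T (m + 1) = sumSpan b c T m ⊔ Submodule.span F {c * b ^ m} := by
  refine le_antisymm (sumSpan_le_iff.2 ⟨le_sup_left.trans le_sup_left, fun i hi => ?_⟩) ?_
  · obtain hi | rfl := (Nat.lt_succ_iff_lt_or_eq).1 hi
    · exact Submodule.mem_sup_left (mul_pow_mem_sumSpan hi)
    · exact Submodule.mem_sup_right (Submodule.mem_span_singleton_self _)
  · rw [sup_le_iff, sumSpan_le_iff, Submodule.span_singleton_le_iff_mem]
    exact ⟨⟨le_sup_left, fun i hi => mul_pow_mem_sumSpan (by omega)⟩,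
      mul_pow_mem_sumSpan m.lt_succ_self⟩

theorem finrank_sumSpan_le [FiniteDimensional F K] (m : ℕ) :
    Module.finrank F (sumSpan b c T m) ≤ Module.finrank F T + m := by
  induction m with
  | zero => rw [sumSpan_zero]; rfl
  | succ m ih =>
    rw [sumSpan_succ]
    have := Submodule.finrank_add_le_finrank_add_finrank (sumSpan b c T m)
      (Submodule.span F {c * b ^ m})
    have : Module.finrank F (Submodule.span F {c * b ^ m}) ≤ 1 := by
      simpa using finrank_span_le_card ({c * b ^ m} : Set K)
    omega

theorem sumSpan_finrank_adjoin_eq_top [FiniteDimensional F K]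
    (hT : IsCompl (Submodule.span F⟮b⟯ {c}) T) :
    sumSpan b c T (Module.finrank F F⟮b⟯) = ⊤ := by
  refine eq_top_iff.2 fun x _ => ?_
  obtain ⟨y, hy, s, hs, rfl⟩ := Submodule.mem_sup.1 (hT.sup_eq_top.ge (Submodule.mem_top (x := x)))
  refine Submodule.add_mem _ ?_ (Submodule.mem_sup_left hs)
  obtain ⟨z, rfl⟩ := Submodule.mem_span_singleton.1 hy
  let pb := IntermediateField.adjoin.powerBasis (K := F) (IsIntegral.of_finite F b)
  rw [← pb.basis.sum_repr z, Finset.sum_smul]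
  refine Submodule.sum_mem _ fun i _ => ?_
  rw [smul_assoc]
  refine Submodule.smul_mem _ _ ?_
  have : pb.basis i • c = c * b ^ (i : ℕ) := by
    simp [pb, Algebra.smul_def, mul_comm]
  rw [this, pb.finrank]
  exact mul_pow_mem_sumSpan i.2

end SumSpan

section ClubData

variable {F K : Type*} [Field F] [Field K] [Algebra F K] {b : K}

theorem exists_apply_mul_pow_eq [FiniteDimensional F K] {f : K →ₗ[F] F} (hf : f ≠ 0) {d : ℕ}
    (hd : Module.finrank F F⟮b⟯ = d + 1) :
    ∃ c : K, (∀ i < d, f (c * b ^ i) = 0) ∧ f (c * b ^ d) = 1 := by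
  obtain ⟨a, ha⟩ : ∃ a, f a ≠ 0 := by simpa using DFunLike.ne_iff.1 hf
  let pb := IntermediateField.adjoin.powerBasis (K := F) (IsIntegral.of_finite F b)
  have hdim : pb.dim = d + 1 := by rw [← pb.finrank, hd]
  obtain ⟨μ, hμ⟩ := exists_forall_apply_smul_smul_eq
    (mt apply_eq_zero_of_mem_kerCore ha) (pb.basis.coord ⟨d, by omega⟩)
  have apply_basis (i : Fin pb.dim) :
      f (μ * a * b ^ (i : ℕ)) = if (i : ℕ) = d then 1 else 0 := by
    have h := hμ (pb.basis i)
    rw [Module.Basis.coord_apply, Module.Basis.repr_self, Finsupp.single_apply] at h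
    simpa [pb, Algebra.smul_def, mul_comm, Fin.ext_iff] using h
  refine ⟨μ * a, fun i hi => ?_, ?_⟩
  · rw [apply_basis ⟨i, by omega⟩, if_neg hi.ne]
  · rw [apply_basis ⟨d, by omega⟩, if_pos rfl]

variable {c : K} {f : K →ₗ[F] F} {d : ℕ}

theorem apply_pow_mul_eq_zero_of_mem_sumSpan (hc : ∀ i < d, f (c * b ^ i) = 0) {j m : ℕ}
    (hjm : m + j ≤ d) {x : K} (hx : x ∈ sumSpan b c (kerCore F⟮b⟯ f) m) : f (b ^ j * x) = 0 := by
  suffices sumSpan b c (kerCore F⟮b⟯ f) m ≤ (f ∘ₗ LinearMap.mulLeft F (b ^ j)).ker from this hx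
  refine sumSpan_le_iff.2 ⟨fun y hy => ?_, fun i hi => ?_⟩
  · exact mem_kerCore.1 hy (IntermediateField.AdjoinSimple.gen F b ^ j)
  · have : b ^ j * (c * b ^ i) = c * b ^ (i + j) := by ring
    simpa [this] using hc (i + j) (by omega)

theorem mem_sumSpan_of_apply_pow_mul_eq_zero (hc : ∀ i < d, f (c * b ^ i) = 0)
    (hcd : f (c * b ^ d) = 1) {j m : ℕ} (hjm : m + j = d) {x : K}
    (hx : x ∈ sumSpan b c (kerCore F⟮b⟯ f) (m + 1)) (hfx : f (b ^ j * x) = 0) :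
    x ∈ sumSpan b c (kerCore F⟮b⟯ f) m := by
  rw [sumSpan_succ] at hx
  obtain ⟨y, hy, _, hz, rfl⟩ := Submodule.mem_sup.1 hx
  obtain ⟨r, rfl⟩ := Submodule.mem_span_singleton.1 hz
  have hr : f (b ^ j * (y + r • (c * b ^ m))) = r := by
    have : b ^ j * (c * b ^ m) = c * b ^ d := by rw [← hjm]; ring
    rw [mul_add, map_add, apply_pow_mul_eq_zero_of_mem_sumSpan hc hjm.le hy, mul_smul_comm,
      map_smul, this, hcd, smul_eq_mul, mul_one, zero_add]
  obtain rfl : r = 0 := hr.symm.trans hfx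
  simpa using hy

theorem notMem_kerCore_of_apply_mul_pow_eq_one (hcd : f (c * b ^ d) = 1) :
    c ∉ kerCore F⟮b⟯ f := fun h => by
  have := mem_kerCore.1 h (IntermediateField.AdjoinSimple.gen F b ^ d)
  simp [Algebra.smul_def, mul_comm _ c, hcd] at this

theorem sumSpan_kerCore_eq [FiniteDimensional F K] {m : ℕ} (hm : Module.finrank F F⟮b⟯ = m + 2)
    (hc : ∀ i < m + 1, f (c * b ^ i) = 0) (hcd : f (c * b ^ (m + 1)) = 1) {S : Submodule F K}
    (hS : Module.finrank F S + 2 = Module.finrank F K)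
    (hf : S ⊔ S.map (LinearMap.mulLeft F b) ≤ f.ker) :
    sumSpan b c (kerCore F⟮b⟯ f) m = S := by
  have c_notMem : c ∉ kerCore F⟮b⟯ f := notMem_kerCore_of_apply_mul_pow_eq_one hcd
  symm
  refine Submodule.eq_of_le_of_finrank_le (fun x hx => ?_) ?_
  · have hx_top : x ∈ sumSpan b c (kerCore F⟮b⟯ f) (m + 2) := by
      rw [← hm, sumSpan_finrank_adjoin_eq_top (isCompl_span_singleton_kerCore c_notMem)]
      trivial
    refine mem_sumSpan_of_apply_pow_mul_eq_zero hc hcd (j := 1) rfl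
      (mem_sumSpan_of_apply_pow_mul_eq_zero hc hcd (j := 0) rfl hx_top ?_) ?_
    · rw [pow_zero, one_mul]
      exact hf (Submodule.mem_sup_left hx)
    · rw [pow_one]
      exact hf (Submodule.mem_sup_right ⟨x, hx, rfl⟩)
  · have := finrank_sumSpan_le (c := c) (T := kerCore F⟮b⟯ f) m
    have := Module.finrank_mul_finrank F F⟮b⟯ (kerCore F⟮b⟯ f)
    have := Module.finrank_mul_finrank F F⟮b⟯ K
    have := finrank_kerCore_add_one c_notMem
    nlinarith

/- Let `f` vanish on `S + b S` but not at `a`. Then `S̄` is the largest `F(b)`-subspace of `ker f`,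
and `c` is such that `z ↦ f (z c)` is the top coordinate of `F(b)` for `1, b, …, b^{t-1}`. -/
theorem exists_isClubData [FiniteDimensional F K] {S : Submodule F K} {a : K}
    (hS : Module.finrank F S + 2 = Module.finrank F K) (h1 : (1 : K) ∈ S)
    (hb : b ∉ (⊥ : IntermediateField F K)) (ha : a ∉ S ⊔ S.map (LinearMap.mulLeft F b)) :
    ∃ (t l : ℕ) (c : K) (T : Submodule F⟮b⟯ K),
      IsClubData (Module.finrank F K) t l a b c T ∧ sumSpan b c T (t - 2) = S := by
  obtain ⟨f, hfa, hf⟩ := Submodule.exists_dual_map_eq_bot_of_notMem ha inferInstance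
  obtain ⟨m, hm⟩ : ∃ m, Module.finrank F F⟮b⟯ = m + 2 := by
    have : Module.finrank F F⟮b⟯ ≠ 1 := mt IntermediateField.finrank_adjoin_simple_eq_one_iff.1 hb
    have : 0 < Module.finrank F F⟮b⟯ := Module.finrank_pos
    exact ⟨Module.finrank F F⟮b⟯ - 2, by omega⟩
  obtain ⟨c, hc, hcd⟩ := exists_apply_mul_pow_eq (f := f) (by rintro rfl; simp at hfa) hm
  have c_notMem : c ∉ kerCore F⟮b⟯ f := notMem_kerCore_of_apply_mul_pow_eq_one hcd
  have sumSpan_eq : sumSpan b c (kerCore F⟮b⟯ f) m = S :=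
    sumSpan_kerCore_eq hm hc hcd hS (LinearMap.le_ker_iff_map.2 hf)
  exact ⟨m + 2, Module.finrank F⟮b⟯ (kerCore F⟮b⟯ f), c, kerCore F⟮b⟯ f,
    { two_le := by omega
      degree := by
        rw [← hm, finrank_kerCore_add_one c_notMem, Module.finrank_mul_finrank F F⟮b⟯ K]
      a_ne := by rintro rfl; simp at hfa
      b_ne := by rintro rfl; exact hb (zero_mem _)
      c_ne := by rintro rfl; exact c_notMem (zero_mem _)
      finrank_adjoin := hm
      finrank_S := rfl
      disjoint := (isCompl_span_singleton_kerCore c_notMem).inf_eq_bot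
      one_mem := by simpa [sumSpan_eq] using h1
      a_notMem := fun h => hfa <| by
        simpa using apply_pow_mul_eq_zero_of_mem_sumSpan hc (j := 0) le_rfl h }, sumSpan_eq⟩

theorem mem_clubSpace {t : ℕ} {a : K} {T : Submodule F⟮b⟯ K} {w : Fin 2 → K} :
    w ∈ clubSpace t a b c T ↔ ∃ s ∈ sumSpan b c T (t - 2), ∃ α β : F,
      w = ![s + algebraMap F K α + algebraMap F K β * a,
        algebraMap F K α + algebraMap F K β * b] := by
  have powers_eq_range :
      {y | ∃ i < t - 2, y = c * b ^ i} = Set.range fun i : Fin (t - 2) => c * b ^ (i : ℕ) := by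
    ext y
    simp [Fin.exists_iff, eq_comm]
  have sum_eq (x : Fin (t - 2) → F) : ∑ i, c * algebraMap F K (x i) * b ^ (i : ℕ) =
      ∑ i, x i • (c * b ^ (i : ℕ)) :=
    Finset.sum_congr rfl fun i _ => by rw [Algebra.smul_def]; ring
  constructor
  · rintro ⟨s, hs, x, α, β, rfl⟩
    refine ⟨s + ∑ i, c * algebraMap F K (x i) * b ^ (i : ℕ), Submodule.add_mem_sup hs ?_,
      α, β, rfl⟩
    rw [powers_eq_range, Submodule.mem_span_range_iff_exists_fun]
    exact ⟨x, (sum_eq x).symm⟩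
  · rintro ⟨_, hsum, α, β, rfl⟩
    obtain ⟨s, hs, y, hy, rfl⟩ := Submodule.mem_sup.1 hsum
    rw [powers_eq_range, Submodule.mem_span_range_iff_exists_fun] at hy
    obtain ⟨x, rfl⟩ := hy
    exact ⟨s, hs, x, α, β, by rw [sum_eq]⟩

end ClubData

section Transport

variable {F K V : Type*} [Field F] [Field K] [AddCommGroup V] [Module K V] [Module F V]

theorem mk_mem_points {W : Submodule K V} {v : V} (hv : v ≠ 0) :
    Projectivization.mk K v hv ∈ points W ↔ v ∈ W := by
  rw [points, Set.mem_ofPred_eq, Projectivization.submodule_mk, Submodule.span_singleton_le_iff_mem]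

theorem mem_submodule_mk {u v : V} (hv : v ≠ 0) :
    u ∈ (Projectivization.mk K v hv).submodule ↔ ∃ k : K, k • v = u := by
  rw [Projectivization.submodule_mk, Submodule.mem_span_singleton]

theorem mk_eq_iff_mem_submodule {u : V} (hu : u ≠ 0) {P : ℙ K V} :
    Projectivization.mk K u hu = P ↔ u ∈ P.submodule := by
  induction P using Projectivization.ind with
  | h v hv => rw [mem_submodule_mk, Projectivization.mk_eq_mk_iff']

theorem mem_linearSet_iff {U : Submodule F V} {P : ℙ K V} :
    P ∈ linearSet K U ↔ ∃ u ∈ U, u ≠ 0 ∧ u ∈ P.submodule := by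
  constructor
  · rintro ⟨u, hu, huU, hP⟩
    exact ⟨u, huU, hu, (mk_eq_iff_mem_submodule hu).1 hP.symm⟩
  · rintro ⟨u, huU, hu, huP⟩
    exact ⟨u, hu, huU, ((mk_eq_iff_mem_submodule hu).2 huP).symm⟩

theorem submodule_smul (g : V ≃ₗ[K] V) (P : ℙ K V) :
    (g • P).submodule = P.submodule.map (g : V →ₗ[K] V) := by
  induction P using Projectivization.ind with
  | h v hv =>
    rw [Projectivization.smul_mk, Projectivization.submodule_mk, Projectivization.submodule_mk,
      Submodule.map_span, Set.image_singleton]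
    rfl

theorem smul_mem_points {W : Submodule K V} (g : V ≃ₗ[K] V) (P : ℙ K V) :
    g • P ∈ points W ↔ P ∈ points (W.comap (g : V →ₗ[K] V)) := by
  simp only [points, Set.mem_ofPred_eq, submodule_smul, Submodule.map_le_iff_le_comap]

theorem smul_mem_points_map {W : Submodule K V} (g : V ≃ₗ[K] V) (P : ℙ K V) :
    g • P ∈ points (W.map (g : V →ₗ[K] V)) ↔ P ∈ points W := by
  rw [smul_mem_points, Submodule.comap_map_eq_of_injective g.injective]

theorem ProjEquiv.trans {A B C : Set (ℙ K V)} (h : ProjEquiv A B) (h' : ProjEquiv B C) :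
    ProjEquiv A C := by
  obtain ⟨g, rfl⟩ := h
  obtain ⟨g', rfl⟩ := h'
  exact ⟨g' * g, by rw [Set.image_image]; simp only [mul_smul]⟩

variable [Algebra F K] [IsScalarTower F K V]

theorem smul_mem_linearSet_map (g : V ≃ₗ[K] V) {U : Submodule F V} {P : ℙ K V} :
    g • P ∈ linearSet K (U.map (g.restrictScalars F : V →ₗ[F] V)) ↔ P ∈ linearSet K U := by
  simp only [mem_linearSet_iff, submodule_smul, Submodule.mem_map]
  constructor
  · rintro ⟨_, ⟨u, hu, rfl⟩, h0, u', hu', h⟩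
    obtain rfl : u' = u := g.injective h
    exact ⟨u', hu, fun h => h0 (by simp [h]), hu'⟩
  · rintro ⟨u, hu, h0, hu'⟩
    exact ⟨g u, ⟨u, hu, rfl⟩, by simpa using h0, u, hu', rfl⟩

theorem weight_map_smul (g : V ≃ₗ[K] V) (U : Submodule F V) (P : ℙ K V) :
    weight (U.map (g.restrictScalars F : V →ₗ[F] V)) (g • P) = weight U P := by
  have inf_eq : U.map (g.restrictScalars F : V →ₗ[F] V) ⊓ (g • P).submodule.restrictScalars F =
      (U ⊓ P.submodule.restrictScalars F).map (g.restrictScalars F : V →ₗ[F] V) := by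
    rw [Submodule.map_inf _ (g.restrictScalars F).injective, submodule_smul]
    rfl
  rw [weight, inf_eq, LinearEquiv.finrank_map_eq]
  rfl

/-- `P` is the head of the `i`-club `L_U`: it has weight `i`, and all other points of `L_U` have
weight one. -/
def IsHead (i : ℕ) (U : Submodule F V) (P : ℙ K V) : Prop :=
  P ∈ linearSet K U ∧ weight U P = i ∧ ∀ Q ∈ linearSet K U, Q ≠ P → weight U Q = 1

theorem IsHead.map_smul {i : ℕ} {U : Submodule F V} {P : ℙ K V} (hP : IsHead i U P)
    (g : V ≃ₗ[K] V) : IsHead i (U.map (g.restrictScalars F : V →ₗ[F] V)) (g • P) := by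
  obtain ⟨hPU, weight_P, weight_ne⟩ := hP
  refine ⟨(smul_mem_linearSet_map g).2 hPU, by rw [weight_map_smul, weight_P], fun Q hQ hne => ?_⟩
  obtain ⟨R, rfl⟩ := MulAction.surjective g Q
  rw [weight_map_smul]
  exact weight_ne R ((smul_mem_linearSet_map g).1 hQ) fun h => hne (by rw [h])

theorem IsClub.map {i : ℕ} {U : Submodule F (Fin 2 → K)} (hU : IsClub i U)
    (g : (Fin 2 → K) ≃ₗ[K] (Fin 2 → K)) :
    IsClub i (U.map (g.restrictScalars F : (Fin 2 → K) →ₗ[F] (Fin 2 → K))) := by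
  obtain ⟨P, hP⟩ := hU
  exact ⟨g • P, IsHead.map_smul hP g⟩

end Transport

section NormalForm

variable {F K : Type*} [Field F] [Field K] [Algebra F K]

theorem mem_bot_of_weight_mk_eq_one {V : Type*} [AddCommGroup V] [Module K V] [Module F V]
    [IsScalarTower F K V] {U : Submodule F V} {u : V} (hu : u ≠ 0)
    (hweight : weight U (Projectivization.mk K u hu) = 1) (huU : u ∈ U) {b : K}
    (hbu : b • u ∈ U) : b ∈ (⊥ : IntermediateField F K) := by
  have smul_mem (k : K) (hk : k • u ∈ U) :
      k • u ∈ U ⊓ (Projectivization.mk K u hu).submodule.restrictScalars F :=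
    ⟨hk, (mem_submodule_mk hu).2 ⟨k, rfl⟩⟩
  have u_mem := smul_mem 1 (by rwa [one_smul])
  rw [one_smul] at u_mem
  obtain ⟨r, hr⟩ := (finrank_eq_one_iff_of_nonzero' (⟨u, u_mem⟩ : ↥(U ⊓ _))
    fun h => hu (congrArg Subtype.val h)).1 hweight ⟨b • u, smul_mem b hbu⟩
  have hr : r • u = b • u := congrArg Subtype.val hr
  rw [← algebraMap_smul K r u] at hr
  exact IntermediateField.mem_bot.2 ⟨r, smul_left_injective K hu hr⟩

/-- The `F`-subspace `{x | (x, 0) ∈ U}` of `K`. -/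
def firstAxis (U : Submodule F (Fin 2 → K)) : Submodule F K :=
  U.comap (LinearMap.single F (fun _ : Fin 2 => K) 0)

variable {U : Submodule F (Fin 2 → K)}

theorem mem_firstAxis {x : K} : x ∈ firstAxis U ↔ ![x, 0] ∈ U := by
  have : Pi.single 0 x = ![x, 0] := by ext j; fin_cases j <;> rfl
  rw [firstAxis, Submodule.mem_comap, LinearMap.single_apply, this]

theorem sub_mem_firstAxis {u v : Fin 2 → K} (hu : u ∈ U) (hv : v ∈ U) (huv : u 1 = v 1) :
    u 0 - v 0 ∈ firstAxis U := by
  rw [mem_firstAxis]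
  convert U.sub_mem hu hv using 1
  ext j
  fin_cases j <;> simp [huv]

variable (K) in
/-- The point `⟨(1, 0)⟩` of the projective line, the image of the head of a club under the
normalisation of its coordinates. -/
def firstPoint : ℙ K (Fin 2 → K) :=
  Projectivization.mk K ![1, 0] fun h => one_ne_zero (congrFun h 0)

theorem mem_submodule_firstPoint {w : Fin 2 → K} : w ∈ (firstPoint K).submodule ↔ w 1 = 0 := by
  rw [firstPoint, mem_submodule_mk]
  refine ⟨?_, fun h => ⟨w 0, by ext j; fin_cases j <;> simp [h]⟩⟩
  rintro ⟨k, rfl⟩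
  simp

variable (U) in
theorem finrank_firstAxis : Module.finrank F (firstAxis U) = weight U (firstPoint K) := by
  have map_eq : (firstAxis U).map (LinearMap.single F (fun _ : Fin 2 => K) 0) =
      U ⊓ (firstPoint K).submodule.restrictScalars F := by
    rw [firstAxis, Submodule.map_comap_eq, inf_comm]
    congr 1
    ext w
    rw [Submodule.restrictScalars_mem, mem_submodule_firstPoint]
    refine ⟨?_, fun h => ⟨w 0, by ext j; fin_cases j <;> simp [h]⟩⟩
    rintro ⟨x, rfl⟩
    simp
  rw [weight, ← map_eq]
  exact (Submodule.equivMapOfInjective _ (Pi.single_injective (M := fun _ => K) 0) _).finrank_eq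

variable (U) in
theorem finrank_firstAxis_add_finrank_map_proj [FiniteDimensional F K] :
    Module.finrank F (firstAxis U) + Module.finrank F (U.map (LinearMap.proj 1)) =
      Module.finrank F U := by
  let π : U →ₗ[F] K := (LinearMap.proj (R := F) (φ := fun _ : Fin 2 => K) 1).domRestrict U
  have ker_eq : π.ker.map U.subtype = U ⊓ (firstPoint K).submodule.restrictScalars F := by
    ext w
    simp [mem_submodule_firstPoint, π, and_comm]
  rw [finrank_firstAxis, weight, ← ker_eq, Submodule.finrank_map_subtype_eq, add_comm,
    ← LinearMap.range_domRestrict]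
  exact LinearMap.finrank_range_add_finrank_ker π

/- If `a = s + b s'` with `s, s' ∈ firstAxis U`, then `U` contains both `(s', 1)` and its multiple
`(b s', b)`, so the point `⟨(s', 1)⟩` has weight at least two. -/
theorem notMem_sup_of_weight_eq_one
    (hU : ∀ Q ∈ linearSet K U, Q ≠ firstPoint K → weight U Q = 1)
    (h01 : ![0, 1] ∈ U) {a b : K} (hab : ![a, b] ∈ U) (hb : b ∉ (⊥ : IntermediateField F K)) :
    a ∉ firstAxis U ⊔ (firstAxis U).map (LinearMap.mulLeft F b) := by
  intro ha
  obtain ⟨s, hs, _, ⟨s', hs', rfl⟩, rfl⟩ := Submodule.mem_sup.1 ha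
  rw [LinearMap.mulLeft_apply] at hab
  have hu : (![s', 1] : Fin 2 → K) ≠ 0 := fun h => one_ne_zero (congrFun h 1)
  have huU : ![s', 1] ∈ U := by
    simpa using U.add_mem (mem_firstAxis.1 hs') h01
  have hbu : b • ![s', 1] ∈ U := by
    simpa using U.sub_mem hab (mem_firstAxis.1 hs)
  refine hb (mem_bot_of_weight_mk_eq_one hu (hU _ ⟨_, hu, huU, rfl⟩ fun h => ?_) huU hbu)
  simpa using mem_submodule_firstPoint.1 ((mk_eq_iff_mem_submodule hu).1 h)

theorem exists_notMem_bot_forall_mem_eq {Y : Submodule F K} (hY : Module.finrank F Y = 2)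
    (h1 : (1 : K) ∈ Y) : ∃ b ∈ Y, b ∉ (⊥ : IntermediateField F K) ∧
      ∀ y ∈ Y, ∃ α β : F, y = algebraMap F K α + algebraMap F K β * b := by
  obtain ⟨b, hbY, hb⟩ : ∃ b ∈ Y, b ∉ Submodule.span F {(1 : K)} := by
    by_contra! hle
    have := Submodule.finrank_mono hle
    rw [hY, finrank_span_singleton one_ne_zero] at this
    omega
  have hb' (r : F) : r • (1 : K) ≠ b := fun h => hb (Submodule.mem_span_singleton.2 ⟨r, h⟩)
  have linInd : LinearIndependent F ![(1 : K), b] :=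
    (LinearIndependent.pair_iff' one_ne_zero).2 hb'
  have span_eq : Submodule.span F {1, b} = Y := by
    have : FiniteDimensional F Y := Module.finite_of_finrank_pos (by omega)
    refine Submodule.eq_of_le_of_finrank_le ?_ ?_
    · rw [Submodule.span_le, Set.pair_subset_iff]
      exact ⟨h1, hbY⟩
    · have := finrank_span_eq_card linInd
      rw [Matrix.range_cons_cons_empty, Fintype.card_fin] at this
      rw [hY, this]
  refine ⟨b, hbY, fun h => ?_, fun y hy => ?_⟩
  · obtain ⟨r, hr⟩ := IntermediateField.mem_bot.1 h
    exact hb' r (by rw [← Algebra.algebraMap_eq_smul_one, hr])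
  · rw [← span_eq] at hy
    obtain ⟨α, β, rfl⟩ := Submodule.mem_span_pair.1 hy
    exact ⟨α, β, by simp [Algebra.smul_def]⟩

theorem IsHead.exists_eq_clubSpace [FiniteDimensional F K] {d : ℕ}
    (hU : Module.finrank F U = Module.finrank F K) (hd : d + 2 = Module.finrank F K)
    (hhead : IsHead d U (firstPoint K)) (h10 : ![1, 0] ∈ U) (h01 : ![0, 1] ∈ U) :
    ∃ (t l : ℕ) (a b c : K) (T : Submodule F⟮b⟯ K),
      IsClubData (Module.finrank F K) t l a b c T ∧ U = clubSpace t a b c T := by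
  obtain ⟨-, weight_eq, weight_ne⟩ := hhead
  have finrank_axis : Module.finrank F (firstAxis U) = d := by rw [finrank_firstAxis, weight_eq]
  have finrank_proj :
      Module.finrank F (U.map (LinearMap.proj (φ := fun _ : Fin 2 => K) 1)) = 2 := by
    have := finrank_firstAxis_add_finrank_map_proj U
    omega
  obtain ⟨_, ⟨w, hw, rfl⟩, hb, proj_eq⟩ :=
    exists_notMem_bot_forall_mem_eq finrank_proj ⟨_, h01, rfl⟩
  obtain ⟨a, b, rfl⟩ : ∃ a b, w = ![a, b] := ⟨w 0, w 1, by ext j; fin_cases j <;> rfl⟩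
  change b ∉ _ at hb
  have h11 : ![1, 1] ∈ U := by simpa using U.add_mem h10 h01
  obtain ⟨t, l, c, T, hdata, hT⟩ := exists_isClubData (by omega) (mem_firstAxis.2 h10) hb
    (notMem_sup_of_weight_eq_one weight_ne h01 hw hb)
  refine ⟨t, l, a, b, c, T, hdata, Submodule.ext fun u => ?_⟩
  rw [mem_clubSpace, hT]
  constructor
  · intro hu
    obtain ⟨α, β, hαβ⟩ := proj_eq (u 1) ⟨u, hu, rfl⟩
    refine ⟨_, sub_mem_firstAxis hu (U.add_mem (U.smul_mem α h11) (U.smul_mem β hw)) ?_, α, β, ?_⟩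
    · simpa [Algebra.smul_def] using hαβ
    · ext j
      fin_cases j
      · simp [Algebra.smul_def]; ring
      · exact hαβ
  · rintro ⟨s, hs, α, β, rfl⟩
    convert U.add_mem (mem_firstAxis.1 hs) (U.add_mem (U.smul_mem α h11) (U.smul_mem β hw)) using 1
    ext j
    fin_cases j
    · simp [Algebra.smul_def, add_assoc]
    · simp [Algebra.smul_def]

theorem exists_linearEquiv_apply_eq_of_finrank_eq_two {V : Type*} [AddCommGroup V] [Module K V]
    (hV : Module.finrank K V = 2) {u v u' v' : V} (huv : LinearIndependent K ![u, v])
    (huv' : LinearIndependent K ![u', v']) : ∃ g : V ≃ₗ[K] V, g u = u' ∧ g v = v' := by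
  have hcard : Fintype.card (Fin 2) = Module.finrank K V := by rw [hV, Fintype.card_fin]
  let B := basisOfLinearIndependentOfCardEqFinrank huv hcard
  let B' := basisOfLinearIndependentOfCardEqFinrank huv' hcard
  have apply_basis (i : Fin 2) : B.equiv B' (Equiv.refl _) (![u, v] i) = ![u', v'] i := by
    simpa [B, B'] using B.equiv_apply i B' (Equiv.refl _)
  exact ⟨B.equiv B' (Equiv.refl _), apply_basis 0, apply_basis 1⟩

theorem IsClub.exists_map_eq_clubSpace [FiniteDimensional F K] {d : ℕ}
    (hU : Module.finrank F U = Module.finrank F K) (hd : d + 2 = Module.finrank F K)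
    (hclub : IsClub d U) :
    ∃ (g : (Fin 2 → K) ≃ₗ[K] (Fin 2 → K)) (t l : ℕ) (a b c : K) (T : Submodule F⟮b⟯ K),
      IsClubData (Module.finrank F K) t l a b c T ∧
      U.map (g.restrictScalars F : (Fin 2 → K) →ₗ[F] (Fin 2 → K)) = clubSpace t a b c T := by
  obtain ⟨P, hhead⟩ := hclub
  obtain ⟨u, hu, hu0, huP⟩ := mem_linearSet_iff.1 hhead.1
  obtain rfl := (mk_eq_iff_mem_submodule hu0).2 huP
  obtain ⟨v, hv, hvP⟩ : ∃ v ∈ U, v ∉ (Projectivization.mk K u hu0).submodule := by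
    by_contra! hle
    have weight_eq := hhead.2.1
    rw [weight, inf_eq_left.2 hle] at weight_eq
    omega
  rw [mem_submodule_mk, not_exists] at hvP
  obtain ⟨g, hgu, hgv⟩ := exists_linearEquiv_apply_eq_of_finrank_eq_two (Module.finrank_fin_fun K)
    ((LinearIndependent.pair_iff' hu0).2 hvP) (u' := ![1, 0]) (v' := ![0, 1])
    (LinearIndependent.pair_iff.2 fun s t h => ⟨by simpa using congrFun h 0,
      by simpa using congrFun h 1⟩)
  have g_smul : g • Projectivization.mk K u hu0 = firstPoint K := by
    rw [Projectivization.smul_mk, mk_eq_iff_mem_submodule, mem_submodule_firstPoint]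
    simp [hgu]
  obtain ⟨t, l, a, b, c, T, hdata, hT⟩ := IsHead.exists_eq_clubSpace
    (U := U.map (g.restrictScalars F : (Fin 2 → K) →ₗ[F] (Fin 2 → K)))
    (by rw [LinearEquiv.finrank_map_eq, hU]) hd (g_smul ▸ IsHead.map_smul hhead g)
    ⟨u, hu, hgu⟩ ⟨v, hv, hgv⟩
  exact ⟨g, t, l, a, b, c, T, hdata, hT⟩

end NormalForm

section Elations

variable {K V : Type*} [Field K] [AddCommGroup V] [Module K V]

theorem isLine_span_pair {u v : V} (h : LinearIndependent K ![u, v]) :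
    IsLine (Submodule.span K {u, v}) := by
  rw [IsLine, ← Matrix.range_cons_cons_empty u v ![], finrank_span_eq_card h, Fintype.card_fin]

theorem exists_forall_apply_eq_smul_of_forall_smul_eq {W : Submodule K V} {g : V ≃ₗ[K] V}
    (hg : ∀ P ∈ points W, g • P = P) : ∃ k : K, ∀ w ∈ W, g w = k • w := by
  have exists_smul (w : V) (hw : w ∈ W) : ∃ k : K, k • w = g w := by
    obtain rfl | hw0 := eq_or_ne w 0
    · exact ⟨0, by simp⟩
    · have hfix := hg _ ((mk_mem_points hw0).2 hw)
      rwa [Projectivization.smul_mk, Projectivization.mk_eq_mk_iff'] at hfix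
  have apply_mem (w : V) (hw : w ∈ W) : g w ∈ W := by
    obtain ⟨k, hk⟩ := exists_smul w hw
    exact hk ▸ W.smul_mem k hw
  obtain ⟨k, hk⟩ := LinearMap.exists_eq_smul_id_of_forall_notLinearIndependent
    (f := (g : V →ₗ[K] V).restrict apply_mem) fun w hli => by
      obtain ⟨k, hk⟩ := exists_smul w w.2
      exact (LinearIndependent.pair_iff' (hli.ne_zero 0)).1 hli k (Subtype.ext hk)
  exact ⟨k, fun w hw => congrArg Subtype.val (LinearMap.congr_fun hk ⟨w, hw⟩)⟩

theorem apply_mem_span_pair_of_map_eq {g : V ≃ₗ[K] V} {c v : V} (hc : c ≠ 0)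
    (hg : ∀ M : Submodule K V, IsLine M → Projectivization.mk K c hc ∈ points M →
      M.map (g : V →ₗ[K] V) = M)
    (hv : ∀ k : K, k • c ≠ v) : g v ∈ Submodule.span K {c, v} := by
  have map_eq := hg _ (isLine_span_pair ((LinearIndependent.pair_iff' hc).2 hv))
    ((mk_mem_points hc).2 (Submodule.subset_span (by simp)))
  rw [← map_eq]
  exact Submodule.mem_map_of_mem (Submodule.subset_span (by simp))

/- Let `c` span the centre. Off the axis `g v = x v + y c`, and comparing the images of `v` and
`v + w` for `w ∈ W \ ⟨c⟩` shows that `x` is the scalar by which `g` acts on `W`. -/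
theorem IsElation.exists_scalar {W : Submodule K V} (hW : 1 < Module.finrank K W) {g : V ≃ₗ[K] V}
    (hg : IsElation W g) : ∃ k : K, (∀ w ∈ W, g w = k • w) ∧ ∀ v, g v - k • v ∈ W := by
  obtain ⟨hfix, C, hC, hlines⟩ := hg
  obtain ⟨k, hk⟩ := exists_forall_apply_eq_smul_of_forall_smul_eq hfix
  refine ⟨k, hk, fun v => ?_⟩
  by_cases hv : v ∈ W
  · rw [hk v hv, sub_self]
    exact W.zero_mem
  induction C using Projectivization.ind with
  | h c hc =>
  rw [mk_mem_points] at hC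
  have smul_mem_iff (x : K) : x • v ∈ W ↔ x = 0 :=
    ⟨fun hx => of_not_not fun h0 => hv ((W.smul_mem_iff h0).1 hx), fun hx => by simp [hx]⟩
  have exists_apply_eq (u : V) (hu : u ∉ W) : ∃ x y : K, y • c + x • u = g u := by
    have := apply_mem_span_pair_of_map_eq hc hlines (v := u) fun r h => hu (h ▸ W.smul_mem r hC)
    obtain ⟨y, x, h⟩ := Submodule.mem_span_pair.1 this
    exact ⟨x, y, h⟩
  obtain ⟨w, hw, hwc⟩ : ∃ w ∈ W, w ∉ Submodule.span K {c} := by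
    by_contra! hle
    have := Submodule.finrank_mono hle
    rw [finrank_span_singleton hc] at this
    omega
  obtain ⟨x, y, hxy⟩ := exists_apply_eq v hv
  obtain ⟨x', y', hxy'⟩ := exists_apply_eq (v + w) fun h => hv ((W.add_mem_iff_left hw).1 h)
  rw [map_add, ← hxy, hk w hw] at hxy'
  obtain rfl : x' = x := by
    have : (x' - x) • v = (y - y') • c + (k - x') • w := by linear_combination (norm := module) hxy'
    rw [← sub_eq_zero, ← smul_mem_iff, this]
    exact W.add_mem (W.smul_mem _ hC) (W.smul_mem _ hw)
  obtain rfl : x' = k := by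
    have : (x' - k) • w = (y - y') • c := by linear_combination (norm := module) hxy'
    by_contra h0
    refine hwc ((Submodule.smul_mem_iff _ (sub_ne_zero.2 h0)).1 ?_)
    exact Submodule.mem_span_singleton.2 ⟨_, this.symm⟩
  rw [← hxy, add_sub_cancel_right]
  exact W.smul_mem y hC

/-- The nonzero vectors that represent the points of `A`. -/
def cone (A : Set (ℙ K V)) : Set V := {v | ∃ h : v ≠ 0, Projectivization.mk K v h ∈ A}

variable {A : Set (ℙ K V)}

theorem mk_mem_iff_mem_cone {v : V} (hv : v ≠ 0) : Projectivization.mk K v hv ∈ A ↔ v ∈ cone A :=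
  ⟨fun h => ⟨hv, h⟩, fun ⟨_, h⟩ => h⟩

theorem smul_mem_cone {k : K} (hk : k ≠ 0) {v : V} : k • v ∈ cone A ↔ v ∈ cone A := by
  have mk_smul (hv : v ≠ 0) :
      Projectivization.mk K (k • v) (smul_ne_zero hk hv) = Projectivization.mk K v hv :=
    (Projectivization.mk_eq_mk_iff' K _ _ _ _).2 ⟨k, rfl⟩
  constructor
  · rintro ⟨h, hA⟩
    have hv : v ≠ 0 := (smul_ne_zero_iff.1 h).2
    exact ⟨hv, mk_smul hv ▸ hA⟩
  · rintro ⟨h, hA⟩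
    exact ⟨smul_ne_zero hk h, (mk_smul h).symm ▸ hA⟩

/- The elation taking `⟨v⟩` to `⟨v + w₁⟩` is a multiple of a translation `v ↦ v + w₁` that fixes
`W`, so it takes `⟨v + w₂⟩` to `⟨v + w₁ + w₂⟩`. -/
theorem add_mem_cone_of_transitive {W : Submodule K V} (hW : 1 < Module.finrank K W)
    (hA : ∀ P ∈ A \ points W, ∀ Q ∈ A \ points W, ∃ g : V ≃ₗ[K] V,
      IsElation W g ∧ (fun R : ℙ K V => g • R) '' A = A ∧ g • P = Q)
    {v w₁ w₂ : V} (hv : v ∉ W) (hw₁ : w₁ ∈ W) (hw₂ : w₂ ∈ W) (hvA : v ∈ cone A)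
    (h₁ : v + w₁ ∈ cone A) (h₂ : v + w₂ ∈ cone A) : v + (w₁ + w₂) ∈ cone A := by
  obtain ⟨hv0, hvA⟩ := hvA
  obtain ⟨h₁0, h₁⟩ := h₁
  obtain ⟨h₂0, h₂⟩ := h₂
  have hvw₁ : v + w₁ ∉ W := fun h => hv ((W.add_mem_iff_left hw₁).1 h)
  obtain ⟨g, hg, image_eq, smul_eq⟩ :=
    hA _ ⟨hvA, mt (mk_mem_points hv0).1 hv⟩ _ ⟨h₁, mt (mk_mem_points h₁0).1 hvw₁⟩
  obtain ⟨k, apply_axis, sub_mem⟩ := hg.exists_scalar hW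
  rw [Projectivization.smul_mk, Projectivization.mk_eq_mk_iff'] at smul_eq
  obtain ⟨μ, hμ : μ • (v + w₁) = g v⟩ := smul_eq
  obtain rfl : μ = k := by
    by_contra hne
    refine hv ((W.smul_mem_iff (sub_ne_zero.2 hne)).1 ?_)
    have : (μ - k) • v = (g v - k • v) - μ • w₁ := by rw [← hμ]; module
    rw [this]
    exact W.sub_mem (sub_mem v) (W.smul_mem μ hw₁)
  have hμ0 : μ ≠ 0 := by
    rintro rfl
    rw [zero_smul, eq_comm, map_eq_zero_iff g g.injective] at hμ
    exact hv0 hμ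
  have smul_mem : g • Projectivization.mk K (v + w₂) h₂0 ∈ A := image_eq ▸ ⟨_, h₂, rfl⟩
  rw [Projectivization.smul_mk, mk_mem_iff_mem_cone] at smul_mem
  have : g • (v + w₂) = μ • (v + (w₁ + w₂)) := by
    rw [LinearEquiv.smul_def, map_add, ← hμ, apply_axis w₂ hw₂]
    module
  rwa [this, smul_mem_cone hμ0] at smul_mem

theorem IsKMArc.preimage_smul {t : ℕ} {A : Set (ℙ K (Fin 3 → K))} (hA : IsKMArc t A)
    (g : (Fin 3 → K) ≃ₗ[K] (Fin 3 → K)) : IsKMArc t ((fun P => g • P) ⁻¹' A) := by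
  have ncard_preimage (B : Set (ℙ K (Fin 3 → K))) : ((fun P => g • P) ⁻¹' B).ncard = B.ncard :=
    Set.ncard_preimage_of_injective_subset_range (MulAction.injective g)
      fun Q _ => MulAction.surjective g Q
  refine ⟨by rw [ncard_preimage, hA.1], fun W hW => ?_⟩
  have inter_eq : (fun P => g • P) ⁻¹' A ∩ points W =
      (fun P => g • P) ⁻¹' (A ∩ points (W.map (g : (Fin 3 → K) →ₗ[K] (Fin 3 → K)))) := by
    ext P
    exact and_congr_right' (smul_mem_points_map g P).symm
  rw [inter_eq, ncard_preimage]
  exact hA.2 _ ((LinearEquiv.finrank_map_eq g W).trans hW)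

theorem projEquiv_preimage_smul (A : Set (ℙ K V)) (g : V ≃ₗ[K] V) :
    ProjEquiv A ((fun P => g • P) ⁻¹' A) := by
  refine ⟨g⁻¹, Set.ext fun P => ?_⟩
  refine ⟨?_, fun hP => ⟨_, hP, inv_smul_smul g P⟩⟩
  rintro ⟨Q, hQ, rfl⟩
  simpa using hQ

end Elations

section PlaneCoordinates

variable {F K : Type*} [Field F] [Field K] [Algebra F K]

theorem embedLine_injective : Function.Injective (embedLine F K) := fun u v h => by
  ext j
  fin_cases j
  exacts [congrFun h 0, congrFun h 1]

theorem embedLine_add_smul (x : Fin 3 → K) :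
    embedLine F K ![x 0, x 1] + x 2 • ![0, 0, 1] = x := by
  ext j
  fin_cases j <;> simp [embedLine]

theorem embedLine_add_smul_inj {u u' : Fin 2 → K} {z z' : K} :
    embedLine F K u + z • ![0, 0, 1] = embedLine F K u' + z' • ![0, 0, 1] ↔ u = u' ∧ z = z' := by
  refine ⟨fun h => ?_, by rintro ⟨rfl, rfl⟩; rfl⟩
  have hz : z = z' := by simpa [embedLine] using congrFun h 2
  subst hz
  exact ⟨embedLine_injective (add_right_cancel h), rfl⟩

variable (K) in
theorem range_embedLine : (embedLine K K).range = lineX2 K := by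
  ext x
  refine ⟨?_, fun hx => ⟨![x 0, x 1], ?_⟩⟩
  · rintro ⟨u, rfl⟩
    rfl
  · have hx : x 2 = 0 := hx
    simpa [hx] using embedLine_add_smul (F := K) x

variable (K) in
theorem isLine_lineX2 : IsLine (lineX2 K) := by
  rw [IsLine, ← range_embedLine, LinearMap.finrank_range_of_inj embedLine_injective,
    Module.finrank_fin_fun]

/-- The point of the plane off the line `X₂ = 0` with affine coordinates `u`. -/
def affinePoint (u : Fin 2 → K) : ℙ K (Fin 3 → K) :=
  Projectivization.mk K (embedLine K K u + ![0, 0, 1]) fun h => by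
    simpa [embedLine] using congrFun h 2

theorem mem_submodule_affinePoint {x : Fin 3 → K} {u : Fin 2 → K} :
    x ∈ (affinePoint u).submodule ↔ ∃ k : K, embedLine K K (k • u) + k • ![0, 0, 1] = x := by
  rw [affinePoint, mem_submodule_mk]
  simp only [smul_add, map_smul]

theorem affinePoint_injective : Function.Injective (affinePoint (K := K)) := by
  intro u v h
  obtain ⟨k, hk⟩ := mem_submodule_affinePoint.1 ((mk_eq_iff_mem_submodule _).1 h)
  obtain ⟨hku, rfl⟩ := embedLine_add_smul_inj.1 (hk.trans (by rw [one_smul]))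
  rw [← hku, one_smul]

theorem affinePoint_notMem (u : Fin 2 → K) : affinePoint u ∉ points (lineX2 K) := by
  rw [affinePoint, mk_mem_points]
  simp [lineX2, embedLine]

theorem exists_eq_affinePoint {P : ℙ K (Fin 3 → K)} (hP : P ∉ points (lineX2 K)) :
    ∃ u, P = affinePoint u := by
  induction P using Projectivization.ind with
  | h x hx =>
    rw [mk_mem_points] at hP
    have hx2 : x 2 ≠ 0 := hP
    refine ⟨(x 2)⁻¹ • ![x 0, x 1], (mk_eq_iff_mem_submodule hx).2 ?_⟩
    refine mem_submodule_affinePoint.2 ⟨x 2, ?_⟩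
    rw [smul_inv_smul₀ hx2, embedLine_add_smul]

/-- The embedding of the projective line in the plane as the line `X₂ = 0`. -/
def linePoint : ℙ K (Fin 2 → K) → ℙ K (Fin 3 → K) :=
  Projectivization.map (embedLine K K) embedLine_injective

theorem linePoint_injective : Function.Injective (linePoint (K := K)) :=
  Projectivization.map_injective _ embedLine_injective

theorem submodule_linePoint (P : ℙ K (Fin 2 → K)) :
    (linePoint P).submodule = P.submodule.map (embedLine K K) := by
  induction P using Projectivization.ind with
  | h v hv =>
    rw [linePoint, Projectivization.map_mk, Projectivization.submodule_mk,
      Projectivization.submodule_mk, Submodule.map_span, Set.image_singleton]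

variable (K) in
theorem range_linePoint : Set.range (linePoint (K := K)) = points (lineX2 K) := by
  ext P
  constructor
  · rintro ⟨Q, rfl⟩
    rw [points, Set.mem_ofPred_eq, submodule_linePoint, ← range_embedLine]
    exact LinearMap.map_le_range
  · induction P using Projectivization.ind with
    | h x hx =>
    rw [mk_mem_points, ← range_embedLine]
    rintro ⟨u, rfl⟩
    exact ⟨Projectivization.mk K u fun h => hx (by rw [h, map_zero]), rfl⟩

/-- The subspace `U' = U ⊕ ⟨(0, 0, 1)⟩_F` attached to the `F`-subspace `U`, which is identified
with a subspace of the line `X₂ = 0`. For `F = K` and a point `P` of that line, it is the line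
joining `P` to `⟨(0, 0, 1)⟩`. -/
def adjoinOrigin (U : Submodule F (Fin 2 → K)) : Submodule F (Fin 3 → K) :=
  U.map (embedLine F K) ⊔ Submodule.span F {![0, 0, 1]}

theorem embedLine_add_smul_mem_adjoinOrigin {U : Submodule F (Fin 2 → K)} {u : Fin 2 → K} {z : K} :
    embedLine K K u + z • ![0, 0, 1] ∈ adjoinOrigin U ↔ u ∈ U ∧ ∃ r, algebraMap F K r = z := by
  rw [adjoinOrigin, Submodule.mem_sup]
  constructor
  · rintro ⟨_, ⟨v, hv, rfl⟩, _, hz, h⟩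
    obtain ⟨r, rfl⟩ := Submodule.mem_span_singleton.1 hz
    rw [← algebraMap_smul K r] at h
    obtain ⟨rfl, rfl⟩ := embedLine_add_smul_inj.1 h
    exact ⟨hv, r, rfl⟩
  · rintro ⟨hu, r, rfl⟩
    refine ⟨_, ⟨u, hu, rfl⟩, r • ![0, 0, 1], Submodule.mem_span_singleton.2 ⟨r, rfl⟩, ?_⟩
    rw [algebraMap_smul]
    rfl

theorem isLine_adjoinOrigin_submodule (P : ℙ K (Fin 2 → K)) :
    IsLine (adjoinOrigin P.submodule) := by
  induction P using Projectivization.ind with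
  | h v hv =>
  rw [adjoinOrigin, Projectivization.submodule_mk, Submodule.map_span, Set.image_singleton,
    ← Submodule.span_union, Set.singleton_union]
  refine isLine_span_pair (LinearIndependent.pair_iff.2 fun k z h => ?_)
  obtain ⟨hkv, hz⟩ := (embedLine_add_smul_inj (F := K) (u := k • v) (u' := 0) (z' := 0)).1
    (by rw [map_smul, h, map_zero, zero_smul, add_zero])
  exact ⟨(smul_eq_zero.1 hkv).resolve_right hv, hz⟩

theorem affinePoint_mem_points_adjoinOrigin {P : ℙ K (Fin 2 → K)} {u : Fin 2 → K} :
    affinePoint u ∈ points (adjoinOrigin P.submodule) ↔ u ∈ P.submodule := by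
  rw [affinePoint, mk_mem_points, ← one_smul K ![(0 : K), 0, 1],
    embedLine_add_smul_mem_adjoinOrigin]
  exact and_iff_left ⟨1, rfl⟩

theorem linePoint_mem_points_adjoinOrigin {P Q : ℙ K (Fin 2 → K)} :
    linePoint Q ∈ points (adjoinOrigin P.submodule) ↔ Q = P := by
  induction Q using Projectivization.ind with
  | h v hv =>
    rw [linePoint, Projectivization.map_mk, mk_mem_points, mk_eq_iff_mem_submodule,
      ← add_zero (embedLine K K v), ← zero_smul K ![(0 : K), 0, 1],
      embedLine_add_smul_mem_adjoinOrigin]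
    exact and_iff_left ⟨0, rfl⟩

theorem exists_linearEquiv_embedLine {ι : (Fin 2 → K) →ₗ[K] (Fin 3 → K)}
    (hι : Function.Injective ι) {v : Fin 3 → K} (hv : v ∉ ι.range) :
    ∃ g : (Fin 3 → K) ≃ₗ[K] (Fin 3 → K),
      (∀ u, g (embedLine K K u) = ι u) ∧ g ![0, 0, 1] = v := by
  let f : (Fin 3 → K) →ₗ[K] (Fin 3 → K) :=
    ι ∘ₗ LinearMap.funLeft K K ![0, 1] + (LinearMap.proj 2).smulRight v
  have f_apply (u : Fin 2 → K) (z : K) : f (embedLine K K u + z • ![0, 0, 1]) = ι u + z • v := by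
    have : LinearMap.funLeft K K ![0, 1] (embedLine K K u + z • ![0, 0, 1]) = u := by
      ext j
      fin_cases j <;> simp [embedLine]
    simp only [f, LinearMap.add_apply, LinearMap.comp_apply, this]
    simp [embedLine]
  have f_injective : Function.Injective f := by
    refine (injective_iff_map_eq_zero f).2 fun x hx => ?_
    rw [← embedLine_add_smul (F := K) x, f_apply] at hx
    have hx2 : x 2 = 0 := by
      by_contra h0
      refine hv ((Submodule.smul_mem_iff _ h0).1 ⟨-![x 0, x 1], ?_⟩)
      rw [map_neg, neg_eq_of_add_eq_zero_right hx]
    rw [hx2, zero_smul, add_zero, map_eq_zero_iff ι hι] at hx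
    rw [← embedLine_add_smul (F := K) x, hx, hx2, map_zero, zero_smul, add_zero]
  refine ⟨LinearEquiv.ofInjectiveEndo f f_injective, fun u => ?_, ?_⟩
  · simpa using f_apply u 0
  · simpa using f_apply 0 1

end PlaneCoordinates

section ArcOf

variable {F K : Type*} [Field F] [Field K] [Algebra F K]

theorem linePoint_mem_linearSet {U : Submodule F (Fin 2 → K)} {P : ℙ K (Fin 2 → K)} :
    linePoint P ∈ linearSet K (U.map (embedLine F K)) ↔ P ∈ linearSet K U := by
  simp only [mem_linearSet_iff, submodule_linePoint, Submodule.mem_map]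
  constructor
  · rintro ⟨_, ⟨u, hu, rfl⟩, h0, v, hv, h⟩
    obtain rfl : v = u := embedLine_injective h
    exact ⟨v, hu, fun h => h0 (by rw [h, map_zero]), hv⟩
  · rintro ⟨u, hu, h0, huP⟩
    exact ⟨_, ⟨u, hu, rfl⟩, (map_ne_zero_iff _ (embedLine_injective (F := F))).2 h0, u, huP, rfl⟩

theorem affinePoint_mem_linearSet {U : Submodule F (Fin 2 → K)} {u : Fin 2 → K} :
    affinePoint u ∈ linearSet K (adjoinOrigin U) ↔ u ∈ U := by
  constructor
  · rw [mem_linearSet_iff]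
    rintro ⟨x, hxU, hx, hxu⟩
    obtain ⟨k, rfl⟩ := mem_submodule_affinePoint.1 hxu
    obtain ⟨hku, r, rfl⟩ := embedLine_add_smul_mem_adjoinOrigin.1 hxU
    have hr : r ≠ 0 := by
      rintro rfl
      simp at hx
    rw [algebraMap_smul] at hku
    exact (U.smul_mem_iff hr).1 hku
  · intro hu
    refine ⟨_, _, ?_, rfl⟩
    rw [← one_smul K ![(0 : K), 0, 1], embedLine_add_smul_mem_adjoinOrigin]
    exact ⟨hu, 1, map_one _⟩

theorem eq_arcOf {A : Set (ℙ K (Fin 3 → K))} {U : Submodule F (Fin 2 → K)}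
    (affine_mem_iff : ∀ u, affinePoint u ∈ A ↔ u ∈ U)
    (line_mem_iff : ∀ P, linePoint P ∈ A ↔ P ∉ linearSet K U) :
    A = arcOf (U.map (embedLine F K)) ![0, 0, 1] := by
  ext P
  rw [arcOf, ← adjoinOrigin]
  by_cases hP : P ∈ points (lineX2 K)
  · obtain ⟨Q, rfl⟩ : P ∈ Set.range linePoint := by rwa [range_linePoint]
    simp [hP, line_mem_iff, linePoint_mem_linearSet]
  · obtain ⟨u, rfl⟩ := exists_eq_affinePoint hP
    simp [hP, affine_mem_iff, affinePoint_mem_linearSet]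

theorem image_smul_arcOf {g : (Fin 3 → K) ≃ₗ[K] (Fin 3 → K)}
    (hg : (lineX2 K).map (g : (Fin 3 → K) →ₗ[K] (Fin 3 → K)) = lineX2 K)
    (U : Submodule F (Fin 3 → K)) (v : Fin 3 → K) :
    (fun P : ℙ K (Fin 3 → K) => g • P) '' arcOf U v =
      arcOf (U.map (g.restrictScalars F : (Fin 3 → K) →ₗ[F] (Fin 3 → K))) (g v) := by
  have map_span : (Submodule.span F {v}).map
      (g.restrictScalars F : (Fin 3 → K) →ₗ[F] (Fin 3 → K)) = Submodule.span F {g v} := by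
    rw [Submodule.map_span, Set.image_singleton]
    rfl
  have smul_mem_line (P : ℙ K (Fin 3 → K)) : g • P ∈ points (lineX2 K) ↔ P ∈ points (lineX2 K) := by
    rw [← smul_mem_points_map g P, hg]
  have smul_mem_iff (P : ℙ K (Fin 3 → K)) : g • P ∈ arcOf (U.map
      (g.restrictScalars F : (Fin 3 → K) →ₗ[F] (Fin 3 → K))) (g v) ↔ P ∈ arcOf U v := by
    rw [arcOf, arcOf, ← map_span, ← Submodule.map_sup]
    simp only [Set.mem_union, Set.mem_sdiff, smul_mem_line, smul_mem_linearSet_map]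
  ext P
  obtain ⟨Q, rfl⟩ := MulAction.surjective g P
  rw [smul_mem_iff, (MulAction.injective g).mem_set_image]

theorem projEquiv_arcOf_map (g : (Fin 2 → K) ≃ₗ[K] (Fin 2 → K)) (U : Submodule F (Fin 2 → K)) :
    ProjEquiv (arcOf (U.map (embedLine F K)) ![0, 0, 1])
      (arcOf ((U.map (g.restrictScalars F : (Fin 2 → K) →ₗ[F] (Fin 2 → K))).map (embedLine F K))
        ![0, 0, 1]) := by
  have range_eq : (embedLine K K ∘ₗ (g : (Fin 2 → K) →ₗ[K] (Fin 2 → K))).range = lineX2 K := by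
    rw [LinearEquiv.range_comp, range_embedLine]
  obtain ⟨h, apply_embedLine, apply_origin⟩ := exists_linearEquiv_embedLine
    (ι := embedLine K K ∘ₗ (g : (Fin 2 → K) →ₗ[K] (Fin 2 → K))) (v := ![0, 0, 1])
    ((embedLine_injective (F := K)).comp g.injective) (by simp [range_eq, lineX2])
  refine ⟨h, ?_⟩
  have comp_eq : (h : (Fin 3 → K) →ₗ[K] (Fin 3 → K)) ∘ₗ embedLine K K =
      embedLine K K ∘ₗ (g : (Fin 2 → K) →ₗ[K] (Fin 2 → K)) := LinearMap.ext apply_embedLine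
  rw [image_smul_arcOf, apply_origin, ← Submodule.map_comp, ← Submodule.map_comp]
  · congr 2
    exact LinearMap.ext apply_embedLine
  · conv_lhs => rw [← range_embedLine, ← LinearMap.range_comp, comp_eq, range_eq]

end ArcOf

section Counting

variable {F K V : Type*} [Field F] [Field K] [AddCommGroup V] [Module K V] [Module F V]
  [Algebra F K] [IsScalarTower F K V] [Finite V]

theorem natCard_inf_submodule (U : Submodule F V) (P : ℙ K V) :
    Nat.card ↥(U ⊓ P.submodule.restrictScalars F) = Nat.card F ^ weight U P :=
  Module.natCard_eq_pow_finrank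

theorem weight_ne_zero_iff {U : Submodule F V} {P : ℙ K V} :
    weight U P ≠ 0 ↔ P ∈ linearSet K U := by
  rw [weight, Ne, Submodule.finrank_eq_zero, ← Ne, Submodule.ne_bot_iff, mem_linearSet_iff]
  simp only [Submodule.mem_inf, Submodule.restrictScalars_mem, and_assoc]
  exact exists_congr fun _ => and_congr_right' and_comm

theorem sum_card_pow_weight_sub_one [Fintype (ℙ K V)] (U : Submodule F V) :
    ∑ P : ℙ K V, (Nat.card F ^ weight U P - 1) = Nat.card U - 1 := by
  classical
  have ncard_nonzero (S : Submodule F V) : ((S : Set V) \ {0}).ncard = Nat.card S - 1 := by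
    rw [Set.ncard_sdiff (by simp), Set.ncard_singleton]
    rfl
  have iUnion_eq :
      (U : Set V) \ {0} = ⋃ P : ℙ K V, ↑(U ⊓ P.submodule.restrictScalars F) \ {0} := by
    ext u
    simp only [Set.mem_iUnion, Set.mem_sdiff, Set.mem_singleton_iff, SetLike.mem_coe,
      Submodule.mem_inf, Submodule.restrictScalars_mem]
    exact ⟨fun ⟨hu, h0⟩ => ⟨_, ⟨hu, (mk_eq_iff_mem_submodule h0).1 rfl⟩, h0⟩,
      fun ⟨_, ⟨hu, _⟩, h0⟩ => ⟨hu, h0⟩⟩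
  rw [← ncard_nonzero, iUnion_eq, Set.ncard_iUnion_of_finite (fun _ => Set.toFinite _),
    finsum_eq_sum_of_fintype]
  · exact Finset.sum_congr rfl fun P _ => by rw [ncard_nonzero, natCard_inf_submodule]
  · refine fun P Q hPQ => Set.disjoint_left.2 fun u ⟨⟨_, huP⟩, h0⟩ ⟨⟨_, huQ⟩, _⟩ => hPQ ?_
    rw [← (mk_eq_iff_mem_submodule h0).2 huP, ← (mk_eq_iff_mem_submodule h0).2 huQ]

/- Truncated subtraction makes the terms vanish exactly at the points of weight at most one. -/
theorem sum_card_pow_weight_sub_card [Finite F] [Fintype (ℙ K V)] (U : Submodule F V) :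
    ∑ P : ℙ K V, (Nat.card F ^ weight U P - Nat.card F) +
      (linearSet K U).ncard * (Nat.card F - 1) = Nat.card U - 1 := by
  classical
  have term_eq (P : ℙ K V) : Nat.card F ^ weight U P - 1 =
      (Nat.card F ^ weight U P - Nat.card F) + if P ∈ linearSet K U then Nat.card F - 1 else 0 := by
    have card_pos : 0 < Nat.card F := Nat.card_pos
    split_ifs with hP <;> rw [← weight_ne_zero_iff] at hP
    · have := Nat.le_self_pow hP (Nat.card F)
      omega
    · rw [of_not_not hP, pow_zero]
      omega
  have ncard_eq : (linearSet K U).ncard = (Finset.univ.filter (· ∈ linearSet K U)).card := by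
    rw [Set.ncard_eq_toFinset_card', ← Set.filter_mem_univ_eq_toFinset]
  rw [← sum_card_pow_weight_sub_one (K := K) U, Finset.sum_congr rfl fun P _ => term_eq P,
    Finset.sum_add_distrib, ← Finset.sum_filter, Finset.sum_const, smul_eq_mul, ncard_eq]

theorem exists_isHead_of_sum_eq [Fintype (ℙ K V)] {U : Submodule F V} {q d : ℕ} (hq : 1 < q)
    (hsum : ∑ P : ℙ K V, (q ^ weight U P - q) + q = q ^ d) (hU : (linearSet K U).Nonempty)
    (hweight : ∀ P ∈ linearSet K U, weight U P = 1 ∨ weight U P = d) :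
    ∃ P : ℙ K V, IsHead d U P := by
  classical
  by_cases! h : ∃ P ∈ linearSet K U, weight U P = d
  · obtain ⟨P, hP, weight_P⟩ := h
    refine ⟨P, hP, weight_P, fun Q hQ hne => ?_⟩
    rw [← Finset.add_sum_erase _ _ (Finset.mem_univ P), weight_P] at hsum
    have sum_erase_eq : ∑ R ∈ Finset.univ.erase P, (q ^ weight U R - q) = 0 := by omega
    have term_eq : q ^ weight U Q - q = 0 :=
      Finset.sum_eq_zero_iff.1 sum_erase_eq Q (Finset.mem_erase.2 ⟨hne, Finset.mem_univ Q⟩)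
    have weight_le : weight U Q ≤ 1 := by
      rw [← Nat.pow_le_pow_iff_right hq, pow_one]
      omega
    have := weight_ne_zero_iff.2 hQ
    omega
  · have weight_eq (P : ℙ K V) (hP : P ∈ linearSet K U) : weight U P = 1 :=
      (hweight P hP).resolve_right (h P hP)
    have sum_eq : ∑ P : ℙ K V, (q ^ weight U P - q) = 0 := Finset.sum_eq_zero fun P _ => by
      by_cases hP : P ∈ linearSet K U
      · simp [weight_eq P hP]
      · rw [of_not_not (mt weight_ne_zero_iff.1 hP), pow_zero]
        omega
    obtain ⟨P, hP⟩ := hU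
    rw [sum_eq, zero_add] at hsum
    have hd : d = 1 := Nat.pow_right_injective hq (by simpa using hsum.symm)
    exact absurd ((weight_eq P hP).trans hd.symm) (h P hP)

end Counting

section AffinePart

variable {F K : Type*} [Field F] [Field K] [Algebra F K] {U : Submodule F (Fin 2 → K)}
  {A : Set (ℙ K (Fin 3 → K))}

theorem inter_points_adjoinOrigin (hU : ∀ u, affinePoint u ∈ A ↔ u ∈ U) (P : ℙ K (Fin 2 → K)) :
    A ∩ points (adjoinOrigin P.submodule) =
      affinePoint '' ↑(U ⊓ P.submodule.restrictScalars F) ∪ (A ∩ {linePoint P}) := by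
  ext R
  by_cases hR : R ∈ points (lineX2 K)
  · have notMem_image : R ∉ affinePoint '' ↑(U ⊓ P.submodule.restrictScalars F) := by
      rintro ⟨u, -, rfl⟩
      exact affinePoint_notMem u hR
    obtain ⟨Q, rfl⟩ : R ∈ Set.range linePoint := by rwa [range_linePoint]
    simp only [Set.mem_inter_iff, linePoint_mem_points_adjoinOrigin, Set.mem_union, notMem_image,
      false_or, Set.mem_singleton_iff, linePoint_injective.eq_iff]
  · have ne_linePoint : R ≠ linePoint P := by
      rintro rfl
      exact hR ((range_linePoint K).subset ⟨P, rfl⟩)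
    obtain ⟨u, rfl⟩ := exists_eq_affinePoint hR
    simp only [Set.mem_inter_iff, hU, affinePoint_mem_points_adjoinOrigin, Set.mem_union,
      affinePoint_injective.mem_set_image, SetLike.mem_coe, Submodule.mem_inf,
      Submodule.restrictScalars_mem, Set.mem_singleton_iff, ne_linePoint, and_false, or_false]

theorem inter_points_lineX2 (hL : ∀ P, linePoint P ∈ A ↔ P ∉ linearSet K U) :
    A ∩ points (lineX2 K) = linePoint '' (linearSet K U)ᶜ := by
  rw [← range_linePoint, ← Set.image_preimage_eq_inter_range]
  exact congrArg _ (Set.ext hL)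

theorem ncard_inter_points_lineX2 (hL : ∀ P, linePoint P ∈ A ↔ P ∉ linearSet K U) :
    (A ∩ points (lineX2 K)).ncard = (linearSet K U)ᶜ.ncard := by
  rw [inter_points_lineX2 hL, Set.ncard_image_of_injective _ linePoint_injective]

variable [Finite K]

theorem ncard_inter_points_adjoinOrigin (hU : ∀ u, affinePoint u ∈ A ↔ u ∈ U)
    (P : ℙ K (Fin 2 → K)) : (A ∩ points (adjoinOrigin P.submodule)).ncard =
      Nat.card F ^ weight U P + (A ∩ {linePoint P}).ncard := by
  have : Finite (ℙ K (Fin 3 → K)) := (Projectivization.finite_iff_of_finite K _).2 inferInstance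
  rw [inter_points_adjoinOrigin hU, Set.ncard_union_eq,
    Set.ncard_image_of_injective _ affinePoint_injective, ← natCard_inf_submodule]
  · rfl
  · refine Set.disjoint_left.2 ?_
    rintro _ ⟨u, -, rfl⟩ ⟨-, h⟩
    exact affinePoint_notMem u ((range_linePoint K).subset ⟨P, h.symm⟩)

theorem ncard_eq_natCard_add_ncard_compl_linearSet (hU : ∀ u, affinePoint u ∈ A ↔ u ∈ U)
    (hL : ∀ P, linePoint P ∈ A ↔ P ∉ linearSet K U) :
    A.ncard = Nat.card U + (linearSet K U)ᶜ.ncard := by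
  have : Finite (ℙ K (Fin 3 → K)) := (Projectivization.finite_iff_of_finite K _).2 inferInstance
  have sdiff_eq : A \ points (lineX2 K) = affinePoint '' (U : Set (Fin 2 → K)) := by
    ext R
    constructor
    · rintro ⟨hR, hR'⟩
      obtain ⟨u, rfl⟩ := exists_eq_affinePoint hR'
      exact ⟨u, (hU u).1 hR, rfl⟩
    · rintro ⟨u, hu, rfl⟩
      exact ⟨(hU u).2 hu, affinePoint_notMem u⟩
  rw [← Set.ncard_inter_add_ncard_sdiff_eq_ncard A (points (lineX2 K)),
    ncard_inter_points_lineX2 hL, sdiff_eq,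
    Set.ncard_image_of_injective _ affinePoint_injective, add_comm]
  rfl

/- Parity: the lines through `⟨(0, 0, 1)⟩` meet `A` in an even number of points, and
`|F| ^ weight U P` is odd exactly when the weight is zero. -/
theorem IsKMArc.linePoint_mem_iff {t : ℕ} (hA : IsKMArc t A) (ht : Even t)
    (hF : Even (Nat.card F)) (hU : ∀ u, affinePoint u ∈ A ↔ u ∈ U) (P : ℙ K (Fin 2 → K)) :
    linePoint P ∈ A ↔ P ∉ linearSet K U := by
  have even_ncard : Even (A ∩ points (adjoinOrigin P.submodule)).ncard := by
    obtain h | h | h := hA.2 _ (isLine_adjoinOrigin_submodule P) <;> rw [h]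
    exacts [Even.zero, even_two, ht]
  rw [ncard_inter_points_adjoinOrigin hU, Nat.even_add, Nat.even_pow, and_iff_right hF,
    weight_ne_zero_iff] at even_ncard
  rw [even_ncard, Nat.not_even_iff_odd]
  by_cases hP : linePoint P ∈ A
  · simp [Set.inter_eq_right.2 (Set.singleton_subset_iff.2 hP), hP]
  · simp [Set.inter_singleton_eq_empty.2 hP, hP]

theorem IsKMArc.card_pow_weight_eq {t : ℕ} (hA : IsKMArc t A)
    (hU : ∀ u, affinePoint u ∈ A ↔ u ∈ U) {P : ℙ K (Fin 2 → K)} (hP : linePoint P ∉ A) :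
    Nat.card F ^ weight U P = 2 ∨ Nat.card F ^ weight U P = t := by
  have : Finite F := Finite.of_injective _ (algebraMap F K).injective
  have ncard_mem := hA.2 _ (isLine_adjoinOrigin_submodule P)
  rw [ncard_inter_points_adjoinOrigin hU, Set.inter_singleton_eq_empty.2 hP, Set.ncard_empty,
    add_zero] at ncard_mem
  exact ncard_mem.resolve_left (pow_pos Nat.card_pos _).ne'

theorem eq_of_two_pow_add_eq {d k s : ℕ} (hd : d ≠ 0) (h : 2 ^ k + s = 2 ^ (d + 2) + 2 ^ d)
    (hs : s = 0 ∨ s = 2 ∨ s = 2 ^ d) : k = d + 2 ∧ s = 2 ^ d := by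
  have two_le : 2 ≤ 2 ^ d := Nat.le_self_pow hd 2
  have pow_lt : 2 ^ k < 2 ^ (d + 3) := by
    rw [pow_add] at h ⊢
    omega
  have k_lt : k < d + 3 := (Nat.pow_lt_pow_iff_right one_lt_two).1 pow_lt
  have pow_le : 2 ^ k ≤ 2 ^ (d + 2) := Nat.pow_le_pow_right two_pos (Nat.le_of_lt_succ k_lt)
  have s_eq : s = 2 ^ d := by omega
  exact ⟨Nat.pow_right_injective le_rfl (show 2 ^ k = 2 ^ (d + 2) by omega), s_eq⟩

theorem IsKMArc.finrank_eq_and_isClub {d : ℕ} (hd : d ≠ 0) (hF : Nat.card F = 2)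
    (hK : Nat.card K = 2 ^ (d + 2)) (hA : IsKMArc (2 ^ d) A)
    (hU : ∀ u, affinePoint u ∈ A ↔ u ∈ U) (hL : ∀ P, linePoint P ∈ A ↔ P ∉ linearSet K U) :
    Module.finrank F U = d + 2 ∧ IsClub d U := by
  have : Finite (ℙ K (Fin 2 → K)) := (Projectivization.finite_iff_of_finite K _).2 inferInstance
  have := Fintype.ofFinite (ℙ K (Fin 2 → K))
  have : Finite F := Finite.of_injective _ (algebraMap F K).injective
  have card_U : Nat.card U = 2 ^ Module.finrank F U := by
    rw [Module.natCard_eq_pow_finrank (K := F), hF]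
  have ncard_compl := hA.2 _ (isLine_lineX2 K)
  rw [ncard_inter_points_lineX2 hL] at ncard_compl
  obtain ⟨finrank_eq, ncard_compl⟩ := eq_of_two_pow_add_eq hd
    (by rw [← card_U, ← hK, ← hA.1, ncard_eq_natCard_add_ncard_compl_linearSet hU hL]) ncard_compl
  have ncard_add := Set.ncard_add_ncard_compl (linearSet K U)
  rw [ncard_compl, Projectivization.card_of_finrank_two K _ (Module.finrank_fin_fun K), hK]
    at ncard_add
  have sum_eq := sum_card_pow_weight_sub_card (K := K) U
  rw [card_U, finrank_eq, hF] at sum_eq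
  have two_le : 2 ≤ 2 ^ d := Nat.le_self_pow hd 2
  rw [pow_add] at ncard_add sum_eq
  refine ⟨finrank_eq, exists_isHead_of_sum_eq one_lt_two (by omega) ?_ fun P hP => ?_⟩
  · rw [← Set.ncard_pos]
    omega
  · have := hA.card_pow_weight_eq hU fun h => (hL P).1 h hP
    rw [hF] at this
    exact this.imp (fun h => Nat.pow_right_injective le_rfl (by simpa using h))
      fun h => Nat.pow_right_injective le_rfl h

end AffinePart

section TranslationArcs

variable {K : Type*} [Field K]

theorem IsKMArc.exists_mem_sdiff {t : ℕ} {A : Set (ℙ K (Fin 3 → K))} (hA : IsKMArc t A)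
    (hK : 2 < Nat.card K) {W : Submodule K (Fin 3 → K)} (hW : IsLine W) :
    ∃ P, P ∈ A \ points W := by
  by_contra! h
  have inter_eq : A ∩ points W = A :=
    Set.inter_eq_left.2 fun P hP => of_not_not fun hPW => h P ⟨hP, hPW⟩
  have ncard_mem := hA.2 W hW
  rw [inter_eq, hA.1] at ncard_mem
  omega

theorem exists_submodule_of_add_mem {p : ℕ} [NeZero p] {M : Type*} [AddCommGroup M]
    [Module (ZMod p) M] {s : Set M} (h0 : 0 ∈ s) (hadd : ∀ u ∈ s, ∀ v ∈ s, u + v ∈ s) :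
    ∃ U : Submodule (ZMod p) M, ∀ u, u ∈ s ↔ u ∈ U := by
  let S : AddSubmonoid M := ⟨⟨s, fun hu hv => hadd _ hu _ hv⟩, h0⟩
  refine ⟨{ S with smul_mem' := fun r u hu => ?_ }, fun u => Iff.rfl⟩
  rw [← ZMod.natCast_zmod_val r, Nat.cast_smul_eq_nsmul]
  exact S.nsmul_mem hu _

/- Take the axis as the line `X₂ = 0` and a point of the arc off the axis as the origin. -/
theorem IsTranslationKMArc.exists_projEquiv {p : ℕ} [NeZero p] [Algebra (ZMod p) K] {t : ℕ}
    {A : Set (ℙ K (Fin 3 → K))} (hA : IsTranslationKMArc t A) (hK : 2 < Nat.card K) :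
    ∃ (B : Set (ℙ K (Fin 3 → K))) (U : Submodule (ZMod p) (Fin 2 → K)),
      ProjEquiv A B ∧ IsKMArc t B ∧ ∀ u, affinePoint u ∈ B ↔ u ∈ U := by
  obtain ⟨hKM, W, hW, htrans⟩ := hA
  obtain ⟨P, hPA, hPW⟩ := hKM.exists_mem_sdiff hK hW
  induction P using Projectivization.ind with
  | h v hv =>
  rw [mk_mem_points] at hPW
  let e : (Fin 2 → K) ≃ₗ[K] W :=
    LinearEquiv.ofFinrankEq _ _ ((Module.finrank_fin_fun K).trans hW.symm)
  obtain ⟨g, apply_embedLine, apply_origin⟩ := exists_linearEquiv_embedLine (v := v)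
    (ι := W.subtype ∘ₗ (e : (Fin 2 → K) →ₗ[K] W)) (W.subtype_injective.comp e.injective)
    (by rwa [LinearEquiv.range_comp, Submodule.range_subtype])
  have affine_mem_iff (u : Fin 2 → K) :
      affinePoint u ∈ (fun P => g • P) ⁻¹' A ↔ v + e u ∈ cone A := by
    rw [Set.mem_preimage, affinePoint, Projectivization.smul_mk, mk_mem_iff_mem_cone,
      LinearEquiv.smul_def, map_add, apply_embedLine, apply_origin, add_comm]
    rfl
  have v_mem : v ∈ cone A := ⟨hv, hPA⟩
  have axis : 1 < Module.finrank K W := hW ▸ one_lt_two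
  have zero_mem : affinePoint 0 ∈ (fun P => g • P) ⁻¹' A := by
    rw [affine_mem_iff]
    simpa using v_mem
  obtain ⟨U, hU⟩ := exists_submodule_of_add_mem (p := p)
    (s := {u | affinePoint u ∈ (fun P => g • P) ⁻¹' A}) zero_mem fun u hu w hw => by
      rw [Set.mem_ofPred_eq, affine_mem_iff] at *
      simpa using add_mem_cone_of_transitive axis htrans hPW (e u).2 (e w).2 v_mem hu hw
  exact ⟨_, U, projEquiv_preimage_smul A g, hKM.preimage_smul g, hU⟩

theorem IsTranslationKMArc.exists_projEquiv_arcOf [Algebra (ZMod 2) K] {d : ℕ} (hd : d ≠ 0)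
    (hK : Nat.card K = 2 ^ (d + 2)) {A : Set (ℙ K (Fin 3 → K))}
    (hA : IsTranslationKMArc (2 ^ d) A) :
    ∃ U : Submodule (ZMod 2) (Fin 2 → K), Module.finrank (ZMod 2) U = d + 2 ∧ IsClub d U ∧
      ProjEquiv A (arcOf (U.map (embedLine (ZMod 2) K)) ![0, 0, 1]) := by
  have : Finite K := Nat.finite_of_card_ne_zero (by rw [hK]; positivity)
  have two_lt : 2 < Nat.card K := by
    rw [hK]
    exact lt_self_pow₀ one_lt_two (by omega)
  obtain ⟨B, U, hAB, hB, hU⟩ := hA.exists_projEquiv (p := 2) two_lt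
  have hL := hB.linePoint_mem_iff (Nat.even_pow.2 ⟨even_two, hd⟩) (by simp) hU
  obtain ⟨finrank_eq, hclub⟩ := hB.finrank_eq_and_isClub hd (Nat.card_zmod 2) hK hU hL
  exact ⟨U, finrank_eq, hclub, eq_arcOf hU hL ▸ hAB⟩

end TranslationArcs

end KMArcs

theorem mainTheorem10 {K : Type*} [Field K] [Algebra (ZMod 2) K] (n : ℕ) (hn : 3 ≤ n)
    (hK : Nat.card K = 2 ^ n) (A : Set (ℙ K (Fin 3 → K)))
    (hA : KMArcs.IsTranslationKMArc (2 ^ (n - 2)) A) :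
    ∃ (t l : ℕ) (a b c : K) (S : Submodule (IntermediateField.adjoin (ZMod 2) {b}) K),
      KMArcs.IsClubData n t l a b c S ∧
      Module.finrank (ZMod 2) (KMArcs.clubSpace t a b c S) = n ∧
      KMArcs.IsClub (n - 2) (KMArcs.clubSpace t a b c S) ∧
      KMArcs.ProjEquiv A
        (KMArcs.arcOf ((KMArcs.clubSpace t a b c S).map (KMArcs.embedLine (ZMod 2) K))
          ![0, 0, 1]) := by
  have : Finite K := Nat.finite_of_card_ne_zero (by rw [hK]; positivity)
  obtain ⟨d, rfl⟩ : ∃ d, n = d + 2 := ⟨n - 2, by omega⟩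
  rw [Nat.add_sub_cancel] at hA ⊢
  have finrank_K : Module.finrank (ZMod 2) K = d + 2 := by
    have card_K := Module.natCard_eq_pow_finrank (K := ZMod 2) (V := K)
    rw [hK, Nat.card_zmod] at card_K
    exact (Nat.pow_right_injective le_rfl card_K).symm
  obtain ⟨U, finrank_U, hclub, hAU⟩ := hA.exists_projEquiv_arcOf (by omega) hK
  rw [← finrank_K]
  obtain ⟨g, t, l, a, b, c, S, hdata, hS⟩ :=
    hclub.exists_map_eq_clubSpace (finrank_U.trans finrank_K.symm) finrank_K.symm
  refine ⟨t, l, a, b, c, S, hdata, ?_, ?_, ?_⟩ <;> rw [← hS]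
  · rw [LinearEquiv.finrank_map_eq, finrank_U, finrank_K]
  · exact hclub.map g
  · exact hAU.trans (KMArcs.projEquiv_arcOf_map g U)
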